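/- An inverse monoid is a monoid $S$ in which every $x$ has a unique $x^{-1}$ with $xx^{-1}x=x$ and $x^{-1}xx^{-1}=x^{-1}$. Its $\mathcal R$-classes are the classes of the equivalence relation $s\mathrel{\mathcal R}t\iff sS=tS$. Write $E(S)$ for its set of idempotents, and let $\leq$ be its natural partial order: $s\leq t$ if and only if $s=et$ for some $e\in E(S)$. For $s\in S$, let $\mu_S(s)$ be the set of maximal elements, with respect to $\leq$, of $\{e\in E(S)\mid e\leq s\}$. For an alphabet $A$ and a set $R$ of pairs of words over $A\cup A^{-1}$, the inverse monoid presented by $\langle A\mid R\rangle$ is the quotient of the free monoid $(A\cup A^{-1})^*$ by the congruence generated by $R$ together with all pairs $(ww^{-1}w,\,w)$ and $(uu^{-1}vv^{-1},\,vv^{-1}uu^{-1})$, where $u,v,w\in(A\cup A^{-1})^*$. Let $I\subseteq\mathbb N\setminus\{0\}$ be infinite, and let $T_I$ be the inverse monoid with presentation $$\langle a,b,c\mid ab^ia=ab^iac\ (i\in I)\rangle.$$ Then: (i) every $\mathcal R$-class of $T_I$ is finite; (ii) $\mu_{T_I}(c)$ is infinite. -/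

import Mathlib

/-- An inverse monoid: every element `x` has exactly one inverse `x⁻¹`, that is, exactly one
element `y` with `x * y * x = x` and `y * x * y = y`. -/
class InverseMonoid (S : Type*) extends Monoid S, Inv S where
  mul_inv_mul_self : ∀ x : S, x * x⁻¹ * x = x
  inv_mul_self_mul_inv : ∀ x : S, x⁻¹ * x * x⁻¹ = x⁻¹
  eq_inv_of_inverse : ∀ x y : S, x * y * x = x → y * x * y = y → y = x⁻¹

namespace InverseMonoid

/-- The `R`-class of `s`: the elements that generate the same principal right ideal as `s`. -/
def rClass {S : Type*} [InverseMonoid S] (s : S) : Set S :=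
  {t | (∃ u : S, s * u = t) ∧ (∃ v : S, t * v = s)}

/-- The natural partial order: `a ≤ b` if and only if `a = e * b` for some idempotent `e`. -/
def natLE {S : Type*} [InverseMonoid S] (a b : S) : Prop :=
  ∃ e : S, IsIdempotentElem e ∧ a = e * b

/-- The set `E(S)` of idempotents of `S`. -/
def idempotents (S : Type*) [InverseMonoid S] : Set S :=
  {e | IsIdempotentElem e}

/-- The set of elements below `s` in the natural partial order. -/
def lowerSet {S : Type*} [InverseMonoid S] (s : S) : Set S :=
  {t | natLE t s}

/-- The set `μ_S(s)` of those idempotents below `s` that are maximal, for the natural partial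
order, among the idempotents below `s`. -/
def mu {S : Type*} [InverseMonoid S] (s : S) : Set S :=
  {e | e ∈ lowerSet s ∩ idempotents S ∧
    ∀ f ∈ lowerSet s ∩ idempotents S, natLE e f → f = e}

end InverseMonoid

namespace InvPres

/-- Words over `A ∪ A⁻¹`: the letter `(x, true)` is `x` and `(x, false)` is its formal inverse. -/
abbrev Word (A : Type*) := FreeMonoid (A × Bool)

/-- The formal inverse of a word: reverse it and invert each letter. -/
def Word.formalInv {A : Type*} (w : Word A) : Word A :=
  FreeMonoid.ofList (FreeGroup.invRev (FreeMonoid.toList w))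

/-- The pairs that generate the Wagner congruence, whose quotient is the free inverse monoid. -/
inductive WagnerRel (A : Type*) : Word A → Word A → Prop
  | regular (w : Word A) : WagnerRel A (w * w.formalInv * w) w
  | comm (u v : Word A) :
      WagnerRel A (u * u.formalInv * (v * v.formalInv)) (v * v.formalInv * (u * u.formalInv))

/-- The inverse monoid defined by the inverse monoid presentation `⟨A | R⟩`: the quotient of the
free monoid on `A ∪ A⁻¹` by the congruence generated by the Wagner relations and `R`. -/
def Presented {A : Type*} (R : Word A → Word A → Prop) : Type _ :=
  PresentedMonoid fun u v => WagnerRel A u v ∨ R u v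

instance Presented.instMonoid {A : Type*} (R : Word A → Word A → Prop) : Monoid (Presented R) :=
  inferInstanceAs (Monoid (PresentedMonoid fun u v => WagnerRel A u v ∨ R u v))

/-- The element of `⟨A | R⟩` represented by a word. -/
def Presented.mk {A : Type*} (R : Word A → Word A → Prop) : Word A →* Presented R :=
  PresentedMonoid.mk fun u v => WagnerRel A u v ∨ R u v

theorem formalInv_mul {A : Type*} (u v : Word A) :
    (u * v).formalInv = v.formalInv * u.formalInv := by
  simp [Word.formalInv, FreeGroup.invRev, FreeMonoid.toList_mul]

theorem formalInv_formalInv {A : Type*} (u : Word A) : u.formalInv.formalInv = u := by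
  simp [Word.formalInv, FreeGroup.invRev_invRev]

theorem Presented.regular {A : Type*} (R : Word A → Word A → Prop) (w : Word A) :
    Presented.mk R w * Presented.mk R w.formalInv * Presented.mk R w = Presented.mk R w := by
  rw [← map_mul, ← map_mul]
  exact PresentedMonoid.mk_eq_mk_of_rel (Or.inl (WagnerRel.regular w))

theorem Presented.comm {A : Type*} (R : Word A → Word A → Prop) (u v : Word A) :
    Presented.mk R u * Presented.mk R u.formalInv *
        (Presented.mk R v * Presented.mk R v.formalInv) =
      Presented.mk R v * Presented.mk R v.formalInv *
        (Presented.mk R u * Presented.mk R u.formalInv) := by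
  simp only [← map_mul]
  exact PresentedMonoid.mk_eq_mk_of_rel (Or.inl (WagnerRel.comm u v))

theorem Presented.mk_surjective {A : Type*} (R : Word A → Word A → Prop) :
    Function.Surjective (Presented.mk R) :=
  PresentedMonoid.surjective_mk

theorem Presented.idem_eq {A : Type*} (R : Word A → Word A → Prop) (w : Word A)
    (h : IsIdempotentElem (Presented.mk R w)) :
    Presented.mk R w = Presented.mk R w * Presented.mk R w.formalInv := by
  have h1 := Presented.regular R w
  have h2 := Presented.regular R w.formalInv
  have h3 := Presented.comm R w w.formalInv
  rw [formalInv_formalInv] at h2 h3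
  unfold IsIdempotentElem at h
  generalize Presented.mk R w = e at *
  generalize Presented.mk R w.formalInv = f at *
  have hf : f = f * e * (e * f) := by
    calc f = f * e * f := h2.symm
      _ = f * (e * e) * f := by rw [h]
      _ = _ := by simp only [mul_assoc]
  have hff : f * f = f := by
    have k1 : f * e * (f * e) = f * e := by rw [← mul_assoc, h2]
    have k2 : e * f * (e * f) = e * f := by rw [← mul_assoc, h1]
    calc f * f = f * e * (e * f) * (f * e * (e * f)) := by rw [← hf]
      _ = f * e * ((e * f) * (f * e)) * (e * f) := by simp only [mul_assoc]
      _ = f * e * (f * e * (e * f)) * (e * f) := by rw [h3]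
      _ = (f * e * (f * e)) * (e * f * (e * f)) := by simp only [mul_assoc]
      _ = f := by rw [k1, k2, ← hf]
  have hef : e = f := by
    calc e = e * f * e := h1.symm
      _ = e * (f * f) * e := by rw [hff]
      _ = e * f * (f * e) := by simp only [mul_assoc]
      _ = f * e * (e * f) := h3
      _ = f := hf.symm
  rw [← hef, h]

theorem Presented.idem_comm {A : Type*} (R : Word A → Word A → Prop) (e f : Presented R)
    (he : IsIdempotentElem e) (hf : IsIdempotentElem f) : e * f = f * e := by
  obtain ⟨u, rfl⟩ := Presented.mk_surjective R e
  obtain ⟨v, rfl⟩ := Presented.mk_surjective R f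
  rw [Presented.idem_eq R u he, Presented.idem_eq R v hf, Presented.comm R u v]

theorem Presented.inverse_unique {A : Type*} (R : Word A → Word A → Prop) (x y z : Presented R)
    (h1 : x * y * x = x) (h2 : y * x * y = y) (h3 : x * z * x = x) (h4 : z * x * z = z) :
    y = z := by
  have a1 : IsIdempotentElem (x * y) := by rw [IsIdempotentElem, ← mul_assoc, h1]
  have a2 : IsIdempotentElem (y * x) := by rw [IsIdempotentElem, ← mul_assoc, h2]
  have a3 : IsIdempotentElem (x * z) := by rw [IsIdempotentElem, ← mul_assoc, h3]
  have a4 : IsIdempotentElem (z * x) := by rw [IsIdempotentElem, ← mul_assoc, h4]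
  calc y = y * x * y := h2.symm
    _ = y * (x * z * x) * y := by rw [h3]
    _ = y * (x * z * (x * y)) := by simp only [mul_assoc]
    _ = y * (x * y * (x * z)) := by rw [Presented.idem_comm R _ _ a3 a1]
    _ = (y * x * y) * x * z := by simp only [mul_assoc]
    _ = y * (x * z * x) * z := by rw [h2, h3]
    _ = (y * x) * (z * x) * z := by simp only [mul_assoc]
    _ = (z * x) * (y * x) * z := by rw [Presented.idem_comm R _ _ a2 a4]
    _ = z * (x * y * x) * z := by simp only [mul_assoc]
    _ = z := by rw [h1, h4]

theorem Presented.regular' {A : Type*} (R : Word A → Word A → Prop) (w : Word A) :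
    Presented.mk R w.formalInv * Presented.mk R w * Presented.mk R w.formalInv =
      Presented.mk R w.formalInv := by
  simpa only [formalInv_formalInv] using Presented.regular R w.formalInv

/-- Inversion on `⟨A | R⟩` is induced by formal inversion of words. -/
instance Presented.instInv {A : Type*} (R : Word A → Word A → Prop) : Inv (Presented R) where
  inv := Quotient.lift (fun w : Word A => Presented.mk R w.formalInv) fun u v h => by
    have h' : Presented.mk R u = Presented.mk R v := Quotient.sound h
    refine Presented.inverse_unique R (Presented.mk R u) _ _
      (Presented.regular R u) (Presented.regular' R u) ?_ ?_
    · rw [h', Presented.regular R v]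
    · rw [h', Presented.regular' R v]

theorem Presented.mk_formalInv {A : Type*} (R : Word A → Word A → Prop) (w : Word A) :
    Presented.mk R w.formalInv = (Presented.mk R w)⁻¹ :=
  rfl

instance Presented.instInverseMonoid {A : Type*} (R : Word A → Word A → Prop) :
    InverseMonoid (Presented R) where
  mul_inv_mul_self x := by
    obtain ⟨u, rfl⟩ := Presented.mk_surjective R x
    exact Presented.regular R u
  inv_mul_self_mul_inv x := by
    obtain ⟨u, rfl⟩ := Presented.mk_surjective R x
    exact Presented.regular' R u
  eq_inv_of_inverse x y h1 h2 := by
    obtain ⟨u, rfl⟩ := Presented.mk_surjective R x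
    exact Presented.inverse_unique R _ _ _ h1 h2 (Presented.regular R u) (Presented.regular' R u)

end InvPres

/-- The three-letter alphabet `{a, b, c}`. -/
inductive Letter
  | a
  | b
  | c

namespace TI

open InvPres

/-- The letters of the alphabet, as words. -/
def wa : Word Letter := FreeMonoid.of (Letter.a, true)

def wb : Word Letter := FreeMonoid.of (Letter.b, true)

def wc : Word Letter := FreeMonoid.of (Letter.c, true)

/-- The defining relations `a bⁱ a = a bⁱ a c` for `i ∈ I`. -/
inductive Rel (I : Set ℕ) : Word Letter → Word Letter → Prop
  | intro (i : ℕ) (hi : i ∈ I) : Rel I (wa * wb ^ i * wa) (wa * wb ^ i * wa * wc)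

end TI

/-- The inverse monoid `T_I = ⟨a, b, c | a bⁱ a = a bⁱ a c (i ∈ I)⟩`. -/
abbrev TI (I : Set ℕ) : Type := InvPres.Presented (TI.Rel I)

/-- The element of `T_I` represented by the letter `c`. -/
def TI.c (I : Set ℕ) : TI I := InvPres.Presented.mk (TI.Rel I) TI.wc

/-! Words act by partial injections on the vertices of an `InverseGraph`. If the two sides of every
defining relation label the same paths, then so do any two words that are equal in the monoid
(`path_iff_of_mk_eq`). Both halves apply this to well-chosen graphs.

(i) Each relation has the form u = uv with v a generator, so in a graph of right multiplication it
only asks for loops. Let w represent s, and let V be the finite set of vertices on the path labelled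
w from ww⁻¹. Deleting the edges that cross the boundary of V deletes no loop, so the relations
survive. If t = su and s = tv, then w = wuv in the monoid, so wuv still labels a path from ww⁻¹;
this path visits t and cannot leave V. Hence the R-class of s lies in V.

(ii) For i in I the idempotents e_i = (abⁱa)⁻¹(abⁱa) are distinct and lie below c. Let w represent
an idempotent f with e_i ≤ f ≤ c. Then w labels a closed path at the last vertex of `graph i`. If it
visits 0, then f e_i = f by `mul_mk_toEnd`, so f = e_i. Otherwise it lifts to `doubleGraph i`, where
no word abʲa labels a path, so that the relations hold vacuously; there c switches sheets, so w and
wc cannot label the same paths, contradicting fc = f. -/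

namespace InverseMonoid

variable {S : Type*} [InverseMonoid S]

theorem isIdempotentElem_mul_inv (x : S) : IsIdempotentElem (x * x⁻¹) := by
  rw [IsIdempotentElem, ← mul_assoc, mul_inv_mul_self]

theorem isIdempotentElem_inv_mul (x : S) : IsIdempotentElem (x⁻¹ * x) := by
  rw [IsIdempotentElem, ← mul_assoc, inv_mul_self_mul_inv]

theorem inv_inv_eq (x : S) : x⁻¹⁻¹ = x :=
  (eq_inv_of_inverse x⁻¹ x (inv_mul_self_mul_inv x) (mul_inv_mul_self x)).symm

end InverseMonoid

/-! ### Inverse graphs as invariants of presented inverse monoids -/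

/-- A graph whose edges are labelled by `A`, in which each label acts by a partial injection. -/
structure InverseGraph (A X : Type*) where
  edge : A → X → X → Prop
  edge_right_unique : ∀ l x y z, edge l x y → edge l x z → y = z
  edge_left_unique : ∀ l x y z, edge l x z → edge l y z → x = y

namespace InverseGraph

open InvPres

variable {A X : Type*} (G : InverseGraph A X)

/-- Traversing an edge labelled `l`, forwards for `(l, true)` and backwards for `(l, false)`. -/
def Step : A × Bool → X → X → Prop
  | (l, true), x, y => G.edge l x y
  | (l, false), x, y => G.edge l y x

/-- There is a path labelled by the word from the first vertex to the second. -/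
def Path (w : Word A) : X → X → Prop :=
  List.rec (motive := fun _ => X → X → Prop) Eq
    (fun l _ P x z => ∃ y, G.Step l x y ∧ P y z) (FreeMonoid.toList w)

@[simp]
theorem path_one {x y : X} : G.Path 1 x y ↔ x = y := Iff.rfl

theorem path_of_mul {l : A × Bool} {w : Word A} {x z : X} :
    G.Path (FreeMonoid.of l * w) x z ↔ ∃ y, G.Step l x y ∧ G.Path w y z := Iff.rfl

@[simp]
theorem path_of {l : A × Bool} {x y : X} : G.Path (FreeMonoid.of l) x y ↔ G.Step l x y := by
  rw [← mul_one (FreeMonoid.of l), path_of_mul]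
  simp

theorem path_mul {u v : Word A} {x z : X} :
    G.Path (u * v) x z ↔ ∃ y, G.Path u x y ∧ G.Path v y z := by
  induction u using FreeMonoid.inductionOn' generalizing x with
  | one => simp
  | of_mul l u ih =>
    simp only [mul_assoc, path_of_mul, ih]
    constructor
    · rintro ⟨p, h, q, h', h''⟩
      exact ⟨q, ⟨p, h, h'⟩, h''⟩
    · rintro ⟨q, ⟨p, h, h'⟩, h''⟩
      exact ⟨p, h, q, h', h''⟩

theorem path_formalInv {w : Word A} {x y : X} : G.Path w.formalInv x y ↔ G.Path w y x := by
  induction w using FreeMonoid.inductionOn' generalizing y with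
  | one => exact eq_comm
  | of_mul l w ih =>
    have hl : Word.formalInv (FreeMonoid.of l) = FreeMonoid.of (l.1, !l.2) := rfl
    rw [formalInv_mul, path_mul, path_of_mul, hl]
    simp only [ih, path_of]
    rcases l with ⟨l, _ | _⟩ <;> exact exists_congr fun _ => and_comm

theorem path_right_unique {w : Word A} {x y z : X} (h : G.Path w x y) (h' : G.Path w x z) :
    y = z := by
  induction w using FreeMonoid.inductionOn' generalizing x with
  | one => exact (h.symm.trans h' :)
  | of_mul l w ih =>
    obtain ⟨p, hp, h⟩ := h
    obtain ⟨q, hq, h'⟩ := h'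
    have : p = q := by
      rcases l with ⟨l, _ | _⟩
      · exact G.edge_left_unique _ _ _ _ hp hq
      · exact G.edge_right_unique _ _ _ _ hp hq
    subst this
    exact ih h h'

theorem path_left_unique {w : Word A} {x y z : X} (h : G.Path w x z) (h' : G.Path w y z) :
    x = y :=
  G.path_right_unique (G.path_formalInv.2 h) (G.path_formalInv.2 h')

theorem path_mul_formalInv {w : Word A} {x y : X} :
    G.Path (w * w.formalInv) x y ↔ x = y ∧ ∃ z, G.Path w x z := by
  simp only [path_mul, path_formalInv]
  constructor
  · rintro ⟨z, h, h'⟩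
    exact ⟨G.path_left_unique h h', z, h⟩
  · rintro ⟨rfl, z, h⟩
    exact ⟨z, h, h⟩

/-- The congruence of words that label the same paths. -/
def pathCon : Con (Word A) where
  r u v := ∀ x y, G.Path u x y ↔ G.Path v x y
  iseqv := ⟨fun _ _ _ => Iff.rfl, fun h x y => (h x y).symm,
    fun h h' x y => (h x y).trans (h' x y)⟩
  mul' h h' x y := by simp only [path_mul, h, h']

/-- The word ww⁻¹ acts as the identity on the vertices where w can be read, and partial identities
commute. -/
theorem path_iff_of_wagnerRel {u v : Word A} (h : WagnerRel A u v) (x y : X) :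
    G.Path u x y ↔ G.Path v x y := by
  cases h with
  | regular =>
    rw [path_mul]
    simp only [path_mul_formalInv]
    constructor
    · rintro ⟨_, ⟨rfl, -⟩, h⟩
      exact h
    · exact fun h => ⟨x, ⟨rfl, y, h⟩, h⟩
  | comm u v =>
    rw [path_mul, path_mul]
    simp only [path_mul_formalInv]
    constructor <;>
    · rintro ⟨_, ⟨rfl, h⟩, rfl, h'⟩
      exact ⟨_, ⟨rfl, h'⟩, rfl, h⟩

theorem path_iff_of_mk_eq {R : Word A → Word A → Prop}
    (hR : ∀ u v, R u v → ∀ x y, G.Path u x y ↔ G.Path v x y) {u v : Word A}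
    (h : Presented.mk R u = Presented.mk R v) (x y : X) : G.Path u x y ↔ G.Path v x y := by
  have hle : conGen (fun u v => WagnerRel A u v ∨ R u v) ≤ G.pathCon := by
    rw [Con.conGen_le]
    rintro u v (h | h)
    · exact G.path_iff_of_wagnerRel h
    · exact hR u v h
  exact hle ((Con.eq _).1 h) x y

end InverseGraph

/-! ### Finiteness of R-classes -/

namespace InvPres.Presented

open InverseMonoid

variable {A : Type*} {R : Word A → Word A → Prop}

/-- The hypothesis puts `s * x` in the R-class of `s`, so s⁻¹s lies below xx⁻¹ and right
multiplication by `x` can be undone at `s`. -/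
theorem mul_mul_inv_of_mul_mul_eq {s x y : Presented R} (h : s * x * y = s) :
    s * x * x⁻¹ = s := by
  have hc := idem_comm R _ _ (isIdempotentElem_inv_mul s) (isIdempotentElem_mul_inv x)
  calc s * x * x⁻¹ = s * (s⁻¹ * s * (x * x⁻¹)) := by
        simp only [← mul_assoc, mul_inv_mul_self]
    _ = s * (x * x⁻¹ * (s⁻¹ * (s * x * y))) := by rw [hc, h]
    _ = s * (x * x⁻¹ * (s⁻¹ * s) * (x * y)) := by simp only [mul_assoc]
    _ = s * (s⁻¹ * s * (x * x⁻¹) * (x * y)) := by rw [hc]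
    _ = s * s⁻¹ * s * (x * x⁻¹ * x) * y := by simp only [mul_assoc]
    _ = s := by rw [mul_inv_mul_self, mul_inv_mul_self, h]

theorem mul_inv_of_mul_eq {s x : Presented R} (h : s * x = s) : s * x⁻¹ = s := by
  have := mul_mul_inv_of_mul_mul_eq (s := s) (x := x) (y := 1) (by rw [mul_one, h])
  rwa [h] at this

theorem mul_eq_of_natLE {f x : Presented R} (hf : IsIdempotentElem f) (h : natLE f x) :
    f * x = f := by
  obtain ⟨e, he, rfl⟩ := h
  have h1 : e * x * e = e * x := by
    rw [idem_comm R _ _ hf he, ← mul_assoc, he]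
  calc e * x * x = e * x * e * x := by rw [h1]
    _ = e * x * (e * x) := mul_assoc _ _ _
    _ = e * x := hf

theorem eq_of_natLE {e f : Presented R} (he : IsIdempotentElem e) (hf : IsIdempotentElem f)
    (h : natLE e f) (h' : f * e = f) : f = e := by
  rw [← h', idem_comm R _ _ hf he, mul_eq_of_natLE he h]

/-- The graph of right multiplication by generators, restricted to the
edges that stay within an `R`-class and do not cross the boundary of a set `V`. -/
def mulGraph (V : Set (Presented R)) : InverseGraph A (Presented R) where
  edge l x y := (x ∈ V ↔ y ∈ V) ∧ x * mk R (FreeMonoid.of (l, true)) = y ∧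
    y * (mk R (FreeMonoid.of (l, true)))⁻¹ = x
  edge_right_unique := by
    rintro l x y z ⟨-, h, -⟩ ⟨-, h', -⟩
    exact h.symm.trans h'
  edge_left_unique := by
    rintro l x y z ⟨-, -, h⟩ ⟨-, -, h'⟩
    exact h.symm.trans h'

theorem mulGraph_step {V : Set (Presented R)} {l : A × Bool} {x y : Presented R} :
    (mulGraph V).Step l x y ↔ (x ∈ V ↔ y ∈ V) ∧ x * mk R (FreeMonoid.of l) = y ∧
      y * (mk R (FreeMonoid.of l))⁻¹ = x := by
  rcases l with ⟨l, _ | _⟩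
  · have h : mk R (FreeMonoid.of (l, false)) = (mk R (FreeMonoid.of (l, true)))⁻¹ := rfl
    rw [h, inv_inv_eq]
    constructor <;>
    · rintro ⟨h1, h2, h3⟩
      exact ⟨h1.symm, h3, h2⟩
  · exact Iff.rfl

theorem mul_mk_of_mulGraph_path {V : Set (Presented R)} {w : Word A} {x y : Presented R}
    (h : (mulGraph V).Path w x y) : x * mk R w = y := by
  induction w using FreeMonoid.inductionOn' generalizing x with
  | one => rwa [InverseGraph.path_one, ← mul_one x] at h
  | of_mul l w ih =>
    obtain ⟨z, hz, h⟩ := h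
    rw [map_mul, ← mul_assoc, (mulGraph_step.1 hz).2.1]
    exact ih h

theorem mem_of_mulGraph_path {V : Set (Presented R)} {w : Word A} {x y : Presented R}
    (h : (mulGraph V).Path w x y) (hx : x ∈ V) : y ∈ V := by
  induction w using FreeMonoid.inductionOn' generalizing x with
  | one => rw [InverseGraph.path_one] at h; rwa [← h]
  | of_mul l w ih =>
    obtain ⟨z, hz, h⟩ := h
    exact ih h ((mulGraph_step.1 hz).1.1 hx)

/-- By `hx` every prefix product stays in the R-class of `x`, so each step is reversible; by `hV` no
step crosses the boundary of `V`. -/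
theorem mulGraph_path {V : Set (Presented R)} {w : Word A} {x z : Presented R}
    (hV : ∀ p q, p * q = w → x * mk R p ∈ V) (hx : x * mk R w * z = x) :
    (mulGraph V).Path w x (x * mk R w) := by
  induction w using FreeMonoid.inductionOn' generalizing x z with
  | one => simp
  | of_mul l w ih =>
    rw [map_mul, ← mul_assoc] at hx ⊢
    refine InverseGraph.path_of_mul _ |>.2 ⟨x * mk R (FreeMonoid.of l), ?_, ?_⟩
    · refine mulGraph_step.2 ⟨iff_of_true ?_ (hV _ w rfl), rfl, ?_⟩
      · simpa using hV 1 _ (one_mul _)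
      · exact mul_mul_inv_of_mul_mul_eq (y := mk R w * z) (by rwa [← mul_assoc])
    · refine ih (z := z * mk R (FreeMonoid.of l)) (fun p q hpq => ?_) (by rw [← mul_assoc, hx])
      rw [mul_assoc, ← map_mul]
      exact hV _ q (by rw [mul_assoc, hpq])

theorem finite_setOf_prefix (w : Word A) : {p : Word A | ∃ q, p * q = w}.Finite := by
  refine (List.finite_toSet (FreeMonoid.toList w).inits).subset ?_
  rintro p ⟨q, rfl⟩
  exact List.mem_inits _ _ |>.2 ⟨q, rfl⟩

/-- If the relations have the form `u = u * v`, with `v` a generator, then every `R`-class is finite. -/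
theorem finite_rClass (hR : ∀ u u', R u u' → ∃ v : A, u' = u * FreeMonoid.of (v, true))
    (s : Presented R) : (rClass s).Finite := by
  obtain ⟨w, rfl⟩ := mk_surjective R s
  set e := mk R w * (mk R w)⁻¹ with he
  have hew : e * mk R w = mk R w := mul_inv_mul_self _
  let V : Set (Presented R) := (fun p => e * mk R p) '' {p | ∃ q, p * q = w}
  refine ((finite_setOf_prefix w).image fun p => e * mk R p).subset ?_
  -- A path labelled `u` ends at a vertex fixed by `v`, so the relation only asks for a loop there,
  -- and a loop never crosses the boundary of `V`.
  have hrel : ∀ u u', R u u' → ∀ x y, (mulGraph V).Path u x y ↔ (mulGraph V).Path u' x y := by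
    intro u u' h x y
    obtain ⟨v, rfl⟩ := hR u u' h
    have huv : mk R u * mk R (FreeMonoid.of (v, true)) = mk R u := by
      rw [← map_mul]
      exact (PresentedMonoid.mk_eq_mk_of_rel (Or.inr h)).symm
    have key : ∀ y, (mulGraph V).Path u x y → y * mk R (FreeMonoid.of (v, true)) = y := by
      intro y hy
      rw [← mul_mk_of_mulGraph_path hy, mul_assoc, huv]
    simp only [InverseGraph.path_mul, InverseGraph.path_of, mulGraph_step]
    constructor
    · intro hy
      exact ⟨y, hy, Iff.rfl, key y hy, mul_inv_of_mul_eq (key y hy)⟩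
    · rintro ⟨z, hz, -, h1, -⟩
      rwa [← h1, key z hz]
  rintro t ⟨⟨u, rfl⟩, v, hv⟩
  obtain ⟨u, rfl⟩ := mk_surjective R u
  obtain ⟨v, rfl⟩ := mk_surjective R v
  have hp : (mulGraph V).Path w e (mk R w) := by
    have := mulGraph_path (V := V) (w := w) (x := e) (z := (mk R w)⁻¹)
      (fun p q h => ⟨p, ⟨q, h⟩, rfl⟩) (by rw [hew])
    rwa [hew] at this
  -- The word `w * u * v` also represents s, so it too labels a path from `e`; after `w * u` that
  -- path is at the given element of the R-class.
  rw [(mulGraph V).path_iff_of_mk_eq hrel (v := w * u * v) (by simp only [map_mul, hv]),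
    InverseGraph.path_mul] at hp
  obtain ⟨t, ht, -⟩ := hp
  have h1 := mul_mk_of_mulGraph_path ht
  rw [map_mul, ← mul_assoc, hew] at h1
  rw [h1]
  exact mem_of_mulGraph_path ht ⟨1, ⟨w, one_mul _⟩, by simp⟩

end InvPres.Presented

/-! ### Maximal idempotents below c -/

namespace TI

open InvPres InverseMonoid InvPres.Presented

/-- The edges of the Schützenberger graph of `(a bⁱ a)⁻¹ (a bⁱ a)`: a path from `0` to `i + 2`
labelled `a bⁱ a`, with a loop labelled `c` at its end. -/
def Edge (i : ℕ) : Letter → ℕ → ℕ → Prop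
  | .a, x, y => y = x + 1 ∧ (x = 0 ∨ x = i + 1)
  | .b, x, y => y = x + 1 ∧ 1 ≤ x ∧ x ≤ i
  | .c, x, y => x = i + 2 ∧ y = i + 2

/-- The Schützenberger graph of `(a bⁱ a)⁻¹ (a bⁱ a)`. -/
def graph (i : ℕ) : InverseGraph Letter ℕ where
  edge := Edge i
  edge_right_unique := by rintro (_ | _ | _) <;> simp only [Edge] <;> omega
  edge_left_unique := by rintro (_ | _ | _) <;> simp only [Edge] <;> omega

/-- Whether a letter is `c`. -/
def isC : Letter → Bool
  | .a => false
  | .b => false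
  | .c => true

/-- The graph obtained from `graph i` by deleting the vertex `0` and unfolding the loop labelled
`c` into a cycle of length two. -/
def doubleGraph (i : ℕ) : InverseGraph Letter (ℕ × Bool) where
  edge l x y := Edge i l x.1 y.1 ∧ x.1 ≠ 0 ∧ y.2 = (x.2 ^^ isC l)
  edge_right_unique := by
    rintro l ⟨x, e⟩ ⟨y, e'⟩ ⟨z, e''⟩ ⟨h, -, rfl⟩ ⟨h', -, rfl⟩
    rw [(graph i).edge_right_unique l x y z h h']
  edge_left_unique := by
    rintro l ⟨x, e⟩ ⟨y, e'⟩ ⟨z, e''⟩ ⟨h, -, k⟩ ⟨h', -, k'⟩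
    rw [(graph i).edge_left_unique l x y z h h']
    rw [show e = e' by simpa using k.symm.trans k']

variable {i j : ℕ} {I : Set ℕ}

theorem graph_path_pow {x y : ℕ} (h : (graph i).Path (wb ^ j) x y) : y = x + j := by
  induction j generalizing x with
  | zero => exact (h.symm :)
  | succ j ih =>
    rw [pow_succ', wb] at h
    obtain ⟨z, ⟨rfl, -⟩, h⟩ := h
    rw [ih h]
    omega

theorem graph_path_wa {x y : ℕ} :
    (graph i).Path wa x y ↔ y = x + 1 ∧ (x = 0 ∨ x = i + 1) :=
  (graph i).path_of

/-- Each a- or b-edge raises the vertex by one. The second a cannot leave 0, so it leaves i + 1;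
then the first a must leave 0, and counting edges gives j = i. -/
theorem graph_path {x y : ℕ} (h : (graph i).Path (wa * wb ^ j * wa) x y) :
    x = 0 ∧ y = i + 2 ∧ j = i := by
  rw [mul_assoc, InverseGraph.path_mul] at h
  obtain ⟨p, hp, h⟩ := h
  obtain ⟨q, hq, h⟩ := ((graph i).path_mul).1 h
  have := graph_path_pow hq
  rw [graph_path_wa] at hp h
  omega

theorem path_graph_pow {x : ℕ} (hx : 1 ≤ x) (h : x + j ≤ i + 1) :
    (graph i).Path (wb ^ j) x (x + j) := by
  induction j generalizing x with
  | zero => rfl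
  | succ j ih =>
    rw [pow_succ']
    refine ⟨x + 1, ⟨rfl, hx, by omega⟩, ?_⟩
    have := ih (x := x + 1) (by omega) (by omega)
    rwa [show x + (j + 1) = x + 1 + j by omega]

theorem path_graph : (graph i).Path (wa * wb ^ i * wa) 0 (i + 2) := by
  refine ((graph i).path_mul).2 ⟨i + 1, ((graph i).path_mul).2 ⟨1, ?_, ?_⟩, ?_⟩
  · exact graph_path_wa.2 ⟨rfl, .inl rfl⟩
  · rw [add_comm]
    exact path_graph_pow le_rfl (by omega)
  · exact graph_path_wa.2 ⟨rfl, .inr rfl⟩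

/-- Among the words abʲa only the one with j = i labels a path, and that path ends at the vertex
carrying the c-loop. -/
theorem graph_rel (u v : Word Letter) (h : Rel I u v) (x y : ℕ) :
    (graph i).Path u x y ↔ (graph i).Path v x y := by
  obtain ⟨j, hj⟩ := h
  rw [InverseGraph.path_mul (v := wc), wc]
  simp only [InverseGraph.path_of]
  constructor
  · exact fun h => ⟨y, h, (graph_path h).2.1, (graph_path h).2.1⟩
  · rintro ⟨z, h, -, rfl⟩
    rwa [(graph_path h).2.1] at h

theorem graph_path_of_doubleGraph_path {w : Word Letter} {x y : ℕ × Bool}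
    (h : (doubleGraph i).Path w x y) : (graph i).Path w x.1 y.1 := by
  induction w using FreeMonoid.inductionOn' generalizing x with
  | one => rw [InverseGraph.path_one] at h ⊢; rw [h]
  | of_mul l w ih =>
    obtain ⟨z, hz, h⟩ := h
    refine ⟨z.1, ?_, ih h⟩
    rcases l with ⟨l, _ | _⟩ <;> exact hz.1

theorem not_doubleGraph_path {x y : ℕ × Bool} :
    ¬ (doubleGraph i).Path (wa * wb ^ j * wa) x y := by
  intro h
  have hx := (graph_path (graph_path_of_doubleGraph_path h)).1
  rw [mul_assoc, wa] at h
  obtain ⟨z, ⟨-, hz, -⟩, -⟩ := h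
  exact hz hx

theorem doubleGraph_rel (u v : Word Letter) (h : Rel I u v) (x y : ℕ × Bool) :
    (doubleGraph i).Path u x y ↔ (doubleGraph i).Path v x y := by
  obtain ⟨j, hj⟩ := h
  refine iff_of_false not_doubleGraph_path fun h => ?_
  obtain ⟨z, h, -⟩ := ((doubleGraph i).path_mul).1 h
  exact not_doubleGraph_path h

/-- Paths lift edge by edge, switching sheets at each c or c⁻¹; `h0` keeps the path away from the
deleted vertex 0. -/
theorem doubleGraph_path_of_graph_path {w : Word Letter} {x y : ℕ} (h : (graph i).Path w x y)
    (h0 : ∀ p q, p * q = w → ¬ (graph i).Path p x 0) (e : Bool) :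
    ∃ e', (doubleGraph i).Path w (x, e) (y, e') := by
  induction w using FreeMonoid.inductionOn' generalizing x e with
  | one => exact ⟨e, by rw [InverseGraph.path_one] at h ⊢; rw [h]⟩
  | of_mul l w ih =>
    obtain ⟨z, hz, h⟩ := h
    obtain ⟨e', he'⟩ := ih h (e := e ^^ isC l.1) fun p q hpq hp =>
      h0 (FreeMonoid.of l * p) q (by rw [mul_assoc, hpq]) ⟨z, hz, hp⟩
    refine ⟨e', (z, e ^^ isC l.1), ?_, he'⟩
    -- The tail of the edge must not be 0: read backwards, it is reached by the one-letter prefix;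
    -- read forwards, by the empty prefix.
    rcases l with ⟨l, _ | _⟩
    · refine ⟨hz, ?_, by simp⟩
      rintro rfl
      exact h0 (FreeMonoid.of (l, false)) w rfl ((graph i).path_of.2 hz)
    · refine ⟨hz, ?_, rfl⟩
      rintro rfl
      exact h0 1 _ (one_mul _) rfl

/-- The label of the path in `graph i` from a vertex to the last vertex. -/
def toEnd (i x : ℕ) : Word Letter :=
  if x = 0 then wa * wb ^ i * wa else if x ≤ i + 1 then wb ^ (i + 1 - x) * wa else 1

theorem mul_toEnd {l : Letter} {x y : ℕ} (h : Edge i l x y) (hl : l ≠ .c) :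
    FreeMonoid.of (l, true) * toEnd i y = toEnd i x := by
  cases l with
  | a =>
    obtain ⟨rfl, rfl | rfl⟩ := h
    · simp [toEnd, wa, mul_assoc]
    · simp [toEnd, wa]
  | b =>
    obtain ⟨rfl, h1, h2⟩ := h
    rw [toEnd, toEnd, if_neg (by omega), if_pos (by omega), if_neg (by omega),
      if_pos (by omega), ← mul_assoc, show i + 1 - x = i + 1 - (x + 1) + 1 by omega, pow_succ']
    rfl
  | c => exact absurd rfl hl

/-- The relation `s * mk _ (toEnd i x) = f` is preserved along every edge. An a- or b-edge removes a
letter from `toEnd` or restores one, and `hs` makes the cancellation legitimate; a c-edge occurs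
only at the last vertex, where `s = f` is fixed by c. -/
theorem mul_mk_toEnd {w : Word Letter} {x y : ℕ} {f s t : TI I} (hf : f * c I = f)
    (h : (graph i).Path w x y) (hs : s * mk _ w * t = s) (hx : s * mk _ (toEnd i x) = f) :
    s * mk _ w * mk _ (toEnd i y) = f := by
  induction w using FreeMonoid.inductionOn' generalizing x s t with
  | one =>
    rw [InverseGraph.path_one] at h
    rw [← h, map_one, mul_one, hx]
  | of_mul l w ih =>
    obtain ⟨z, hz, h⟩ := h
    rw [map_mul, ← mul_assoc] at hs ⊢
    refine ih h (t := t * mk _ (FreeMonoid.of l)) (by rw [← mul_assoc, hs]) ?_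
    have hinv : s * mk _ (FreeMonoid.of l) * (mk _ (FreeMonoid.of l))⁻¹ = s :=
      mul_mul_inv_of_mul_mul_eq (y := mk _ w * t) (by rwa [← mul_assoc])
    have hend : mk (Rel I) (toEnd i (i + 2)) = 1 := by simp [toEnd]
    rcases l with ⟨l, b⟩
    by_cases hl : l = .c
    · subst hl
      have hxz : x = i + 2 ∧ z = i + 2 := by
        cases b
        · exact ⟨hz.2, hz.1⟩
        · exact hz
      obtain ⟨rfl, rfl⟩ := hxz
      rw [hend, mul_one] at hx ⊢
      subst hx
      cases b
      · exact mul_inv_of_mul_eq hf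
      · exact hf
    · cases b
      · rw [← mul_toEnd hz hl, map_mul, ← mul_assoc]
        have hb : mk (Rel I) (FreeMonoid.of (l, false)) = (mk _ (FreeMonoid.of (l, true)))⁻¹ := rfl
        rw [hb, inv_inv_eq] at hinv
        rw [hb, hinv, hx]
      · rw [mul_assoc, ← map_mul, mul_toEnd hz hl, hx]

/-- The word `(a bⁱ a)⁻¹ (a bⁱ a)`. -/
def idemWord (i : ℕ) : Word Letter :=
  (wa * wb ^ i * wa).formalInv * (wa * wb ^ i * wa)

theorem mk_idemWord :
    mk (Rel I) (idemWord i) = (mk _ (wa * wb ^ i * wa))⁻¹ * mk _ (wa * wb ^ i * wa) :=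
  map_mul _ _ _

theorem isIdempotentElem_mk_idemWord : IsIdempotentElem (mk (Rel I) (idemWord i)) :=
  mk_idemWord (I := I) ▸ isIdempotentElem_inv_mul _

theorem graph_path_idemWord {x y : ℕ} :
    (graph i).Path (idemWord j) x y ↔ x = i + 2 ∧ y = i + 2 ∧ j = i := by
  rw [idemWord, InverseGraph.path_mul]
  simp only [InverseGraph.path_formalInv]
  constructor
  · rintro ⟨z, h, h'⟩
    exact ⟨(graph_path h).2.1, (graph_path h').2⟩
  · rintro ⟨rfl, rfl, rfl⟩
    exact ⟨0, path_graph, path_graph⟩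

/-- In `graph i`, the word `idemWord j` labels a loop at i + 2 only when j = i. -/
theorem mk_idemWord_injective : Function.Injective fun i => mk (Rel I) (idemWord i) := by
  intro i j h
  have := ((graph i).path_iff_of_mk_eq graph_rel h (i + 2) (i + 2)).1
    (graph_path_idemWord.2 ⟨rfl, rfl, rfl⟩)
  exact (graph_path_idemWord.1 this).2.2.symm

theorem mk_idemWord_mul_c (hi : i ∈ I) : mk (Rel I) (idemWord i) * c I = mk _ (idemWord i) := by
  have h : mk (Rel I) (wa * wb ^ i * wa * wc) = mk _ (wa * wb ^ i * wa) :=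
    (PresentedMonoid.mk_eq_mk_of_rel (Or.inr (Rel.intro i hi))).symm
  rw [mk_idemWord, mul_assoc, c, ← map_mul, h]

theorem mul_mk_idemWord_of_path {w : Word Letter} (hf : IsIdempotentElem (mk (Rel I) w))
    (hc : mk (Rel I) w * c I = mk _ w) (h : (graph i).Path w (i + 2) (i + 2)) :
    mk (Rel I) w * mk _ (idemWord i) = mk _ w := by
  by_cases h0 : ∃ p q, p * q = w ∧ (graph i).Path p (i + 2) 0
  · obtain ⟨p, q, rfl, hp⟩ := h0
    -- From 0 the route to the end is all of abⁱa, so f factors as f·p·(abⁱa) and absorbs e_i on the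
    -- right.
    have key := mul_mk_toEnd (s := mk (Rel I) (p * q)) (t := mk _ q) hc hp
      (by rw [mul_assoc, ← map_mul]; exact hf) (by simp [toEnd])
    rw [toEnd, if_pos rfl] at key
    generalize mk (Rel I) (p * q) = f at *
    rw [mk_idemWord, ← key]
    simp only [mul_assoc]
    rw [← mul_assoc (mk _ (wa * (wb ^ i * wa))), mul_inv_mul_self]
  · push Not at h0
    obtain ⟨e, he⟩ := doubleGraph_path_of_graph_path h h0 false
    -- Since fc = f, the word wc labels the same path as w, but its last letter would have to be a
    -- c-edge from a vertex to itself, on one sheet.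
    have he' := ((doubleGraph i).path_iff_of_mk_eq doubleGraph_rel
      (v := w * wc) (by rw [map_mul]; exact hc.symm) _ _).1 he
    obtain ⟨y, hy, hyc⟩ := ((doubleGraph i).path_mul).1 he'
    obtain rfl := (doubleGraph i).path_right_unique he hy
    have := ((doubleGraph i).path_of.1 hyc).2.2
    simp [isC] at this

theorem mk_idemWord_mem_mu (hi : i ∈ I) : mk (Rel I) (idemWord i) ∈ mu (c I) := by
  refine ⟨⟨⟨_, isIdempotentElem_mk_idemWord, (mk_idemWord_mul_c hi).symm⟩,
    isIdempotentElem_mk_idemWord⟩, ?_⟩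
  rintro f ⟨hfc, hf⟩ hle
  obtain ⟨w, rfl⟩ := mk_surjective _ f
  refine eq_of_natLE isIdempotentElem_mk_idemWord hf hle
    (mul_mk_idemWord_of_path hf (mul_eq_of_natLE hf hfc) ?_)
  -- From e_i f = e_i, reading `idemWord i` and then `w` gives a loop at i + 2; the first factor is
  -- already a loop, hence so is `w`.
  have h := mul_eq_of_natLE isIdempotentElem_mk_idemWord hle
  rw [← map_mul] at h
  have hp := ((graph i).path_iff_of_mk_eq graph_rel h (i + 2) (i + 2)).2
    (graph_path_idemWord.2 ⟨rfl, rfl, rfl⟩)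
  obtain ⟨y, hy, hw⟩ := ((graph i).path_mul).1 hp
  rwa [(graph_path_idemWord.1 hy).2.1] at hw

end TI

theorem mainTheorem2 (I : Set ℕ) (hI : I.Infinite) (hI0 : ∀ i ∈ I, i ≠ 0) :
    (∀ s : TI I, (InverseMonoid.rClass s).Finite) ∧ (InverseMonoid.mu (TI.c I)).Infinite := by
  refine ⟨InvPres.Presented.finite_rClass ?_, ?_⟩
  · rintro _ _ ⟨i, hi⟩
    exact ⟨.c, rfl⟩
  · refine (hI.image TI.mk_idemWord_injective.injOn).mono ?_
    rintro _ ⟨i, hi, rfl⟩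
    exact TI.mk_idemWord_mem_mu hi
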